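/- Let $d\in\mathbb{N}$, let $M\in\mathbb{R}^{d\times d}$ be symmetric positive semidefinite, let $r\in\mathbb{R}^d$ lie in the range of $M$, and let $\alpha\in\mathbb{R}^d$ have all coordinates nonzero. Set $$\ell(x)=\tfrac12\langle x,Mx\rangle-\langle r,x\rangle,\qquad \mathrm{Lasso}(x,\lambda)=\ell(x)+\lambda\|x\|_1\qquad(x\in\mathbb{R}^d),$$ where $\|x\|_1=\sum_{i=1}^d|x_i|$. For $\varepsilon\in(0,1)$, let $u^\varepsilon:[0,\infty)\to\mathbb{R}^d$ be the solution of the gradient flow $$\frac{\mathrm{d}u}{\mathrm{d}t}=-\nabla_u\big(\ell(u\circ u)\big),\qquad u(0)=\sqrt{\varepsilon}\,\alpha,$$ where $\circ$ is the component-wise product; let $x^\varepsilon(t)=u^\varepsilon(t)\circ u^\varepsilon(t)$ and $\overline{x}^\varepsilon(t)=\frac1t\int_0^t x^\varepsilon(\tau)\,\mathrm{d}\tau$ for $t>0$. For each $s>0$, let $x(s)$ be a minimizer of $\mathrm{Lasso}(\cdot,\frac1s)$ over $\{x\in\mathbb{R}^d : x\ge 0 \text{ coordinate-wise}\}$, and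 assume that $s\mapsto s\,x(s)$ is coordinate-wise nondecreasing on $(0,\infty)$. Then, for every $s>0$, $$\mathrm{Lasso}\Big(\overline{x}^\varepsilon\big(\tfrac{s}{4}\log\tfrac1\varepsilon\big),\tfrac1s\Big)\;\longrightarrow\;\min_{x\ge 0}\mathrm{Lasso}\big(x,\tfrac1s\big)\qquad\text{as }\varepsilon\to0^+ .$$ -/

import Mathlib

noncomputable section

namespace DLN

/-- The component-wise square `u ∘ u` of a vector of `ℝ^d`. -/
def hsq {d : ℕ} (u : EuclideanSpace ℝ (Fin d)) : EuclideanSpace ℝ (Fin d) :=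
  WithLp.toLp 2 (fun i => u i * u i)

/-- The quadratic loss `ℓ(x) = ½ ⟨x, M x⟩ - ⟨r, x⟩`. -/
def loss {d : ℕ} (M : Matrix (Fin d) (Fin d) ℝ) (r x : EuclideanSpace ℝ (Fin d)) : ℝ :=
  1 / 2 * inner ℝ x (Matrix.toEuclideanLin M x) - inner ℝ r x

/-- The lasso objective `Lasso(x, lam) = ℓ(x) + lam * ‖x‖₁`. -/
def lasso {d : ℕ} (M : Matrix (Fin d) (Fin d) ℝ) (r x : EuclideanSpace ℝ (Fin d)) (lam : ℝ) : ℝ :=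
  loss M r x + lam * ∑ i, |x i|

/-- The set of vectors with nonnegative coordinates. -/
def nonnegOrthant (d : ℕ) : Set (EuclideanSpace ℝ (Fin d)) :=
  {x | ∀ i, 0 ≤ x i}

/-- `x` is a minimizer of the positive lasso `min_{x ≥ 0} Lasso(x, lam)`. -/
def IsPosLassoMinimizer {d : ℕ} (M : Matrix (Fin d) (Fin d) ℝ) (r : EuclideanSpace ℝ (Fin d))
    (lam : ℝ) (x : EuclideanSpace ℝ (Fin d)) : Prop :=
  x ∈ nonnegOrthant d ∧ IsMinOn (fun y => lasso M r y lam) (nonnegOrthant d) x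

/-- The value `min_{x ≥ 0} Lasso(x, lam)` of the positive lasso. The infimum is a minimum as soon
as a minimizer exists, see `IsPosLassoMinimizer.eq_posLassoMin`. -/
def posLassoMin {d : ℕ} (M : Matrix (Fin d) (Fin d) ℝ) (r : EuclideanSpace ℝ (Fin d))
    (lam : ℝ) : ℝ :=
  sInf ((fun y => lasso M r y lam) '' nonnegOrthant d)

theorem IsPosLassoMinimizer.eq_posLassoMin {d : ℕ} {M : Matrix (Fin d) (Fin d) ℝ}
    {r : EuclideanSpace ℝ (Fin d)} {lam : ℝ} {x : EuclideanSpace ℝ (Fin d)}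
    (h : IsPosLassoMinimizer M r lam x) : posLassoMin M r lam = lasso M r x lam := by
  have hl : IsLeast ((fun y => lasso M r y lam) '' nonnegOrthant d) (lasso M r x lam) :=
    ⟨⟨x, h.1, rfl⟩, by rintro _ ⟨y, hy, rfl⟩; exact h.2 hy⟩
  exact hl.csInf_eq

/-- `u` solves the gradient flow `du/dt = -∇_u (ℓ(u ∘ u))` on `[0, ∞)` with initial condition
`u(0) = u₀` (the derivative at `t = 0` is one-sided). -/
def IsGradientFlow {d : ℕ} (M : Matrix (Fin d) (Fin d) ℝ) (r u₀ : EuclideanSpace ℝ (Fin d))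
    (u : ℝ → EuclideanSpace ℝ (Fin d)) : Prop :=
  u 0 = u₀ ∧ ∀ t : ℝ, 0 ≤ t →
    HasDerivWithinAt u (-gradient (fun v => loss M r (hsq v)) (u t)) (Set.Ici 0) t

/-- The time average `(1/t) ∫₀ᵗ x(τ) dτ` of the trajectory `x = u ∘ u`. -/
def avgTrajectory {d : ℕ} (u : ℝ → EuclideanSpace ℝ (Fin d)) (t : ℝ) :
    EuclideanSpace ℝ (Fin d) :=
  (1 / t) • ∫ τ in (0 : ℝ)..t, hsq (u τ)

/-- The time `t = (log (1/ε) / 4) s` that corresponds to the rescaled time `s`. -/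
def timeOf (ε s : ℝ) : ℝ :=
  Real.log (1 / ε) / 4 * s

end DLN

end

open Set Filter Topology Matrix

namespace DLN

/-! Put `L = log (1/ε)` and `t = (L/4) s`, and let `Z s` be `s` times the time average of the
trajectory. Integrating the flow gives `X = Z' = α² exp (-L w)`, where `w = 1 - s r + M Z` is the
gradient at `Z` of `F_s z = ½⟨z, M z⟩ - s⟨r, z⟩ + ∑ zᵢ`. The initial factor `ε = exp (-L)` supplies
the `1` in `w`, which is how the ℓ¹ penalty arises.

For large `L` this is an approximate KKT system: `Z' ≥ 0`, `w ≥ -O(log L / L)` (`neg_slack_le`) and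
`⟨Z', w⟩ ≤ O(1/L)` (`dotProduct_slack_le`). The path `z s = s x(s)` satisfies it exactly. Formally,
the derivative of `½⟨Z - z, M (Z - z)⟩` is `⟨Z' - z', w - w_z⟩`, with `w_z` the gradient of `F_s` at
`z`. The KKT relations bound each term by a quantity tending to `0`; monotonicity of `z` serves for
`-⟨z', w⟩`. This is `dist_le`.

By the envelope theorem the gap `F_s Z - F_s z` has derivative `⟨Z', w⟩ - ⟨r, Z - z⟩`. Since `r = M
q`, Cauchy-Schwarz bounds the second term by the `M`-distance (`suboptimality_le`).
Differentiability of `z` is not assumed, so both arguments use finite increments with quadratic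
error. -/

/-- A function whose increments are bounded by `A h + C h ^ 2` grows at most at rate `A`. -/
theorem sub_le_mul_of_step_bound {f : ℝ → ℝ} {A C T : ℝ} (hT : 0 ≤ T)
    (h : ∀ s t, 0 ≤ s → s ≤ t → t ≤ T → f t - f s ≤ A * (t - s) + C * (t - s) ^ 2) :
    f T - f 0 ≤ A * T := by
  have key : ∀ n : ℕ, f T - f 0 ≤ A * T + C * T ^ 2 * (1 / ((n : ℝ) + 1)) := by
    intro n
    have hn : (0 : ℝ) < (n : ℝ) + 1 := by positivity
    -- With `n + 1` equal steps the quadratic errors add up to `C T ^ 2 / (n + 1)`, which vanishes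
    -- as `n → ∞`.
    set e := T / ((n : ℝ) + 1) with he
    have he0 : 0 ≤ e := by positivity
    have hen : ((n : ℝ) + 1) * e = T := by rw [he]; field_simp
    have ind : ∀ k : ℕ, k ≤ n + 1 → f (k * e) - f 0 ≤ k * (A * e + C * e ^ 2) := by
      intro k
      induction k with
      | zero => simp
      | succ k ih =>
        intro hk
        have h1 := ih (by omega)
        have hk' : ((k : ℝ) + 1) ≤ (n : ℝ) + 1 := by exact_mod_cast hk
        have h2 := h (k * e) ((k + 1) * e) (by positivity) (by nlinarith)
          (by rw [← hen]; exact mul_le_mul_of_nonneg_right hk' he0)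
        push_cast
        have h3 : ((k : ℝ) + 1) * e - k * e = e := by ring
        rw [h3] at h2
        linarith
    have h1 := ind (n + 1) le_rfl
    push_cast at h1
    rw [hen] at h1
    have h2 : ((n : ℝ) + 1) * (A * e + C * e ^ 2) = A * T + C * T ^ 2 * (1 / ((n : ℝ) + 1)) := by
      rw [he]; field_simp
    linarith
  have hlim : Tendsto (fun n : ℕ => A * T + C * T ^ 2 * (1 / ((n : ℝ) + 1))) atTop
      (𝓝 (A * T + C * T ^ 2 * 0)) :=
    (tendsto_one_div_add_atTop_nhds_zero_nat.const_mul _).const_add _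
  rw [mul_zero, add_zero] at hlim
  exact ge_of_tendsto' hlim key

theorem sub_le_of_hasDerivWithinAt_Ici {f f' : ℝ → ℝ} {C a b : ℝ} (ha : 0 ≤ a) (hab : a ≤ b)
    (hf : ∀ t, 0 ≤ t → HasDerivWithinAt f (f' t) (Ici 0) t)
    (hC : ∀ t, a ≤ t → t ≤ b → f' t ≤ C) : f b - f a ≤ C * (b - a) := by
  have hd : ∀ t ∈ interior (Icc a b), HasDerivAt f (f' t) t := by
    intro t ht
    rw [interior_Icc] at ht
    exact (hf t (ha.trans ht.1.le)).hasDerivAt (Ici_mem_nhds (ha.trans_lt ht.1))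
  refine (convex_Icc a b).image_sub_le_mul_sub_of_deriv_le (f := f) (C := C) ?_ ?_ ?_ a
    (left_mem_Icc.2 hab) b (right_mem_Icc.2 hab) hab
  · intro t ht
    exact (hf t (ha.trans ht.1)).continuousWithinAt.mono fun y hy => ha.trans hy.1
  · exact fun t ht => (hd t ht).differentiableAt.differentiableWithinAt
  · intro t ht
    rw [(hd t ht).deriv]
    have := interior_subset ht
    exact hC t this.1 this.2

variable {ι : Type*} [Fintype ι]

theorem dotProduct_mulVec_symm {M : Matrix ι ι ℝ} (hM : M.PosSemidef) (v w : ι → ℝ) :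
    v ⬝ᵥ M *ᵥ w = w ⬝ᵥ M *ᵥ v := by
  have h : Mᵀ = M := by simpa using hM.isHermitian.eq
  rw [dotProduct_mulVec, ← mulVec_transpose, h, dotProduct_comm]

theorem dotProduct_mulVec_self_nonneg {M : Matrix ι ι ℝ} (hM : M.PosSemidef) (v : ι → ℝ) :
    0 ≤ v ⬝ᵥ M *ᵥ v := by
  simpa using hM.dotProduct_mulVec_nonneg v

/-- The Cauchy-Schwarz inequality for a positive semidefinite form. -/
theorem dotProduct_mulVec_sq_le {M : Matrix ι ι ℝ} (hM : M.PosSemidef) (v w : ι → ℝ) :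
    (v ⬝ᵥ M *ᵥ w) ^ 2 ≤ (v ⬝ᵥ M *ᵥ v) * (w ⬝ᵥ M *ᵥ w) := by
  have h : ∀ t : ℝ, 0 ≤ (w ⬝ᵥ M *ᵥ w) * (t * t) + (2 * (v ⬝ᵥ M *ᵥ w)) * t + v ⬝ᵥ M *ᵥ v := by
    intro t
    have := dotProduct_mulVec_self_nonneg hM (v + t • w)
    simp only [mulVec_add, mulVec_smul, dotProduct_add, add_dotProduct, smul_dotProduct,
      dotProduct_smul, smul_eq_mul] at this
    rw [dotProduct_mulVec_symm hM w v] at this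
    linarith
  have := discrim_le_zero h
  unfold discrim at this
  linarith

theorem abs_dotProduct_mulVec_le {M : Matrix ι ι ℝ} (hM : M.PosSemidef) (v w : ι → ℝ) {K : ℝ}
    (hK : w ⬝ᵥ M *ᵥ w ≤ K) : |v ⬝ᵥ M *ᵥ w| ≤ √((v ⬝ᵥ M *ᵥ v) * K) :=
  Real.abs_le_sqrt ((dotProduct_mulVec_sq_le hM v w).trans
    (mul_le_mul_of_nonneg_left hK (dotProduct_mulVec_self_nonneg hM v)))

/-! ### The rescaled objective and its optimality conditions -/

/-- The objective `½ ⟨z, M z⟩ - s ⟨r, z⟩ + ∑ zᵢ`, which is the lasso objective in the variable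
`z = s x`, multiplied by `s ^ 2`, on the nonnegative orthant. -/
noncomputable def scaledObj (M : Matrix ι ι ℝ) (r : ι → ℝ) (s : ℝ) (z : ι → ℝ) : ℝ :=
  1 / 2 * (z ⬝ᵥ M *ᵥ z) - s * (r ⬝ᵥ z) + ∑ i, z i

/-- The gradient of `scaledObj M r s`. -/
noncomputable def slack (M : Matrix ι ι ℝ) (r : ι → ℝ) (s : ℝ) (z : ι → ℝ) : ι → ℝ :=
  fun i => 1 - s * r i + (M *ᵥ z) i

theorem slack_dotProduct (M : Matrix ι ι ℝ) (r : ι → ℝ) (s : ℝ) (z v : ι → ℝ) :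
    v ⬝ᵥ slack M r s z = ∑ i, v i - s * (r ⬝ᵥ v) + v ⬝ᵥ M *ᵥ z := by
  simp only [slack, dotProduct, Finset.mul_sum, ← Finset.sum_sub_distrib, ← Finset.sum_add_distrib]
  exact Finset.sum_congr rfl fun i _ => by ring

theorem scaledObj_add {M : Matrix ι ι ℝ} (hM : M.PosSemidef) (r : ι → ℝ) (s : ℝ) (z v : ι → ℝ) :
    scaledObj M r s (z + v) =
      scaledObj M r s z + v ⬝ᵥ slack M r s z + 1 / 2 * (v ⬝ᵥ M *ᵥ v) := by
  rw [slack_dotProduct]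
  simp only [scaledObj, mulVec_add, dotProduct_add, add_dotProduct, Pi.add_apply,
    Finset.sum_add_distrib]
  rw [dotProduct_mulVec_symm hM z v]
  ring

theorem scaledObj_add_time (M : Matrix ι ι ℝ) (r : ι → ℝ) (s t : ℝ) (z : ι → ℝ) :
    scaledObj M r t z = scaledObj M r s z - (t - s) * (r ⬝ᵥ z) := by
  unfold scaledObj; ring

/-- First-order optimality on the nonnegative orthant. -/
theorem slack_nonneg_of_isMin {M : Matrix ι ι ℝ} (hM : M.PosSemidef) {r : ι → ℝ} {s : ℝ}
    {z : ι → ℝ} (hz : 0 ≤ z) (hmin : ∀ y, 0 ≤ y → scaledObj M r s z ≤ scaledObj M r s y) (i : ι) :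
    0 ≤ slack M r s z i := by
  classical
  by_contra! hneg
  set g := slack M r s z i with hg
  set m := M i i with hm
  have hm0 : 0 ≤ m := hM.diag_nonneg
  have step : ∀ h : ℝ, 0 ≤ h → 0 ≤ h * g + 1 / 2 * (h ^ 2 * m) := by
    intro h hh
    have h1 := hmin (z + Pi.single i h)
      (add_nonneg hz (by simpa using hh))
    rw [scaledObj_add hM] at h1
    simp only [single_dotProduct, mulVec_single, Pi.smul_apply] at h1
    simp only [col_apply, MulOpposite.smul_eq_mul_unop, MulOpposite.unop_op] at h1
    rw [← hg, ← hm] at h1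
    linarith
  -- The denominator `m + 1` instead of the optimal `m` covers `m = 0`.
  have h1 := step (-g / (m + 1)) (by apply div_nonneg <;> linarith)
  have h2 : -g / (m + 1) * g + 1 / 2 * ((-g / (m + 1)) ^ 2 * m) =
      -(g ^ 2 / (m + 1) ^ 2 * (m / 2 + 1)) := by field_simp; ring
  rw [h2] at h1
  have : 0 < g ^ 2 / (m + 1) ^ 2 * (m / 2 + 1) := by
    have := sq_pos_of_neg hneg
    positivity
  linarith

/-! ### Mirror flows: a priori bounds -/

/-- The gradient flow in the rescaled time `s`: `Z` is the integral of the trajectory `X`, and the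
trajectory is given by the mirror map. -/
structure IsMirrorFlow (M : Matrix ι ι ℝ) (r a : ι → ℝ) (L : ℝ) (X Z : ℝ → ι → ℝ) : Prop where
  zero : Z 0 = 0
  hasDeriv : ∀ s, 0 ≤ s → ∀ i, HasDerivWithinAt (fun t => Z t i) (X s i) (Ici 0) s
  eq_exp : ∀ s, 0 ≤ s → ∀ i, X s i = a i * Real.exp (-L * slack M r s (Z s) i)

theorem hasDerivWithinAt_dotProduct {Z : ℝ → ι → ℝ} {X : ι → ℝ} {s : ℝ}
    (h : ∀ i, HasDerivWithinAt (fun t => Z t i) (X i) (Ici 0) s) (v : ι → ℝ) :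
    HasDerivWithinAt (fun t => v ⬝ᵥ Z t) (v ⬝ᵥ X) (Ici 0) s := by
  unfold dotProduct
  exact HasDerivWithinAt.fun_sum fun i _ => (h i).const_mul (v i)

theorem hasDerivWithinAt_quadratic {M : Matrix ι ι ℝ} (hM : M.PosSemidef) {Z : ℝ → ι → ℝ}
    {X : ι → ℝ} {s : ℝ} (h : ∀ i, HasDerivWithinAt (fun t => Z t i) (X i) (Ici 0) s) :
    HasDerivWithinAt (fun t => 1 / 2 * (Z t ⬝ᵥ M *ᵥ Z t)) (X ⬝ᵥ M *ᵥ Z s) (Ici 0) s := by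
  have h1 : HasDerivWithinAt (fun t => Z t ⬝ᵥ M *ᵥ Z t)
      (∑ i, (X i * (M *ᵥ Z s) i + Z s i * (M *ᵥ X) i)) (Ici 0) s := by
    unfold dotProduct
    exact HasDerivWithinAt.fun_sum fun i _ =>
      (h i).mul (hasDerivWithinAt_dotProduct h (M i))
  refine (h1.const_mul (1 / 2)).congr_deriv ?_
  rw [Finset.sum_add_distrib]
  have := dotProduct_mulVec_symm hM (Z s) X
  unfold dotProduct at this ⊢
  linarith

namespace IsMirrorFlow

variable {M : Matrix ι ι ℝ} {r a q : ι → ℝ} {L : ℝ} {X Z : ℝ → ι → ℝ}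

theorem pos (h : IsMirrorFlow M r a L X Z) (ha : ∀ i, 0 < a i) {s : ℝ} (hs : 0 ≤ s) (i : ι) :
    0 < X s i := by
  rw [h.eq_exp s hs i]
  exact mul_pos (ha i) (Real.exp_pos _)

theorem hasDeriv_X (h : IsMirrorFlow M r a L X Z) {s : ℝ} (hs : 0 ≤ s) (i : ι) :
    HasDerivWithinAt (fun t => X t i) (-L * X s i * ((M *ᵥ X s) i - r i)) (Ici 0) s := by
  have h1 : HasDerivWithinAt (fun t => slack M r t (Z t) i) ((M *ᵥ X s) i - r i) (Ici 0) s := by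
    unfold slack
    have h2 := hasDerivWithinAt_dotProduct (h.hasDeriv s hs) (M i)
    have h3 : HasDerivWithinAt (fun t : ℝ => 1 - t * r i) (-(1 * r i)) (Ici 0) s :=
      ((hasDerivWithinAt_id s _).mul_const (r i)).const_sub 1
    refine (h3.add h2).congr_deriv ?_
    change -(1 * r i) + (M *ᵥ X s) i = _
    ring
  have h2 := ((h1.const_mul (-L)).exp.const_mul (a i))
  refine (h2.congr (fun t ht => h.eq_exp t ht i) (h.eq_exp s hs i)).congr_deriv ?_
  rw [h.eq_exp s hs i]; ring

theorem monotone (h : IsMirrorFlow M r a L X Z) (ha : ∀ i, 0 < a i) {s t : ℝ} (hs : 0 ≤ s)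
    (hst : s ≤ t) (i : ι) : Z s i ≤ Z t i := by
  have := sub_le_of_hasDerivWithinAt_Ici (f := fun t => -Z t i) (C := 0) hs hst
    (fun t ht => (h.hasDeriv t ht i).neg)
    (fun t ht _ => by have := h.pos ha (hs.trans ht) i; linarith)
  linarith

theorem nonneg (h : IsMirrorFlow M r a L X Z) (ha : ∀ i, 0 < a i) {s : ℝ} (hs : 0 ≤ s) :
    0 ≤ Z s := by
  intro i
  have := h.monotone ha le_rfl hs i
  rwa [h.zero] at this

/-- The loss decreases along the flow. -/
theorem energy_le (hM : M.PosSemidef) (hq : M *ᵥ q = r) (h : IsMirrorFlow M r a L X Z)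
    (ha : ∀ i, 0 < a i) (hL : 1 ≤ L) {s : ℝ} (hs : 0 ≤ s) :
    (X s - q) ⬝ᵥ M *ᵥ (X s - q) ≤ 2 * (a ⬝ᵥ M *ᵥ a) + 2 * (q ⬝ᵥ M *ᵥ q) := by
  have hd : ∀ t, 0 ≤ t → HasDerivWithinAt
      (fun t => 1 / 2 * ((X t - q) ⬝ᵥ M *ᵥ (X t - q)))
      ((fun i => -L * X t i * ((M *ᵥ X t) i - r i)) ⬝ᵥ M *ᵥ (X t - q)) (Ici 0) t := by
    intro t ht
    exact hasDerivWithinAt_quadratic hM (Z := fun t => X t - q)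
      fun i => (h.hasDeriv_X ht i).sub_const (q i)
  have h1 := sub_le_of_hasDerivWithinAt_Ici (C := 0) le_rfl hs hd (fun t ht _ => by
    rw [mulVec_sub, hq]
    refine Finset.sum_nonpos fun i _ => ?_
    simp only [Pi.sub_apply]
    have := mul_nonneg (mul_nonneg (zero_le_one.trans hL) (h.pos ha ht i).le)
      (sq_nonneg ((M *ᵥ X t) i - r i))
    nlinarith)
  have h0 : X 0 = Real.exp (-L) • a := by
    ext i
    rw [h.eq_exp 0 le_rfl i, h.zero]
    simp [slack, mul_comm]
  -- This gives `|X 0 - q|² ≤ 2 |X 0|² + 2 |q|²` in the seminorm of `M`.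
  have h2 := dotProduct_mulVec_self_nonneg hM (X 0 + q)
  have h3 : X 0 ⬝ᵥ M *ᵥ X 0 ≤ a ⬝ᵥ M *ᵥ a := by
    rw [h0]
    simp only [mulVec_smul, smul_dotProduct, dotProduct_smul, smul_eq_mul]
    have e0 := Real.exp_pos (-L)
    have e1 : Real.exp (-L) ≤ 1 := Real.exp_le_one_iff.2 (by linarith)
    have e2 : Real.exp (-L) * Real.exp (-L) ≤ 1 := by nlinarith
    rw [← mul_assoc]
    exact mul_le_of_le_one_left (dotProduct_mulVec_self_nonneg hM a) e2
  simp only [mulVec_sub, mulVec_add, dotProduct_add, add_dotProduct, dotProduct_sub,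
    sub_dotProduct] at h1 h2 ⊢
  linarith

theorem abs_dotProduct_residual_le (hM : M.PosSemidef) (hq : M *ᵥ q = r)
    (h : IsMirrorFlow M r a L X Z) (ha : ∀ i, 0 < a i) (hL : 1 ≤ L) {s : ℝ} (hs : 0 ≤ s)
    (v : ι → ℝ) :
    |v ⬝ᵥ (M *ᵥ X s - r)| ≤
      √((v ⬝ᵥ M *ᵥ v) * (2 * (a ⬝ᵥ M *ᵥ a) + 2 * (q ⬝ᵥ M *ᵥ q))) := by
  have := abs_dotProduct_mulVec_le hM v (X s - q) (h.energy_le hM hq ha hL hs)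
  have e : M *ᵥ (X s - q) = M *ᵥ X s - r := by rw [mulVec_sub, hq]
  rwa [e] at this

theorem abs_dotProduct_le (hM : M.PosSemidef) (hq : M *ᵥ q = r)
    (h : IsMirrorFlow M r a L X Z) (ha : ∀ i, 0 < a i) (hL : 1 ≤ L) {s : ℝ} (hs : 0 ≤ s) :
    |r ⬝ᵥ X s| ≤
      |r ⬝ᵥ q| + √((q ⬝ᵥ M *ᵥ q) * (2 * (a ⬝ᵥ M *ᵥ a) + 2 * (q ⬝ᵥ M *ᵥ q))) := by
  have h1 := h.abs_dotProduct_residual_le hM hq ha hL hs q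
  have h2 : r ⬝ᵥ X s = r ⬝ᵥ q + q ⬝ᵥ (M *ᵥ X s - r) := by
    rw [dotProduct_sub, dotProduct_mulVec_symm hM, hq, dotProduct_comm (X s) r,
      dotProduct_comm q r]
    ring
  rw [h2]
  exact (abs_add_le _ _).trans (by linarith)

/-- Approximate complementary slackness: each term is `a w exp (-L w)`, and `y exp (-y) ≤ 1` at `y =
L w`. -/
theorem dotProduct_slack_le (h : IsMirrorFlow M r a L X Z) (ha : ∀ i, 0 < a i) (hL : 0 < L)
    {s : ℝ} (hs : 0 ≤ s) : X s ⬝ᵥ slack M r s (Z s) ≤ (∑ i, a i) / L := by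
  rw [Finset.sum_div]
  refine Finset.sum_le_sum fun i _ => ?_
  rw [h.eq_exp s hs i, le_div_iff₀ hL]
  set w := slack M r s (Z s) i
  have h1 : L * w * Real.exp (-L * w) ≤ 1 := by
    have h2 := Real.add_one_le_exp (L * w)
    have h3 : Real.exp (L * w) * Real.exp (-L * w) = 1 := by
      rw [← Real.exp_add]; simp
    nlinarith [Real.exp_pos (-L * w)]
  have := mul_le_mul_of_nonneg_left h1 (ha i).le
  linarith

theorem hasDeriv_scaledObj (hM : M.PosSemidef) (h : IsMirrorFlow M r a L X Z) {s : ℝ}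
    (hs : 0 ≤ s) :
    HasDerivWithinAt (fun t => scaledObj M r t (Z t))
      (X s ⬝ᵥ slack M r s (Z s) - r ⬝ᵥ Z s) (Ici 0) s := by
  unfold scaledObj
  have h1 := hasDerivWithinAt_quadratic hM (h.hasDeriv s hs)
  have h2 := (hasDerivWithinAt_id s (Ici 0)).mul
    (hasDerivWithinAt_dotProduct (h.hasDeriv s hs) r)
  have h3 := HasDerivWithinAt.fun_sum (u := Finset.univ) fun i _ => h.hasDeriv s hs i
  refine ((h1.sub h2).add h3).congr_deriv ?_
  rw [slack_dotProduct]
  simp only [id]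
  ring

variable {R : ℝ}

theorem dotProduct_sub_le (h : IsMirrorFlow M r a L X Z) (hR : ∀ s, 0 ≤ s → |r ⬝ᵥ X s| ≤ R)
    {s t : ℝ} (hs : 0 ≤ s) (hst : s ≤ t) : |r ⬝ᵥ Z t - r ⬝ᵥ Z s| ≤ R * (t - s) := by
  have hd : ∀ t, 0 ≤ t → HasDerivWithinAt (fun t => r ⬝ᵥ Z t) (r ⬝ᵥ X t) (Ici 0) t :=
    fun t ht => hasDerivWithinAt_dotProduct (h.hasDeriv t ht) r
  have h1 := sub_le_of_hasDerivWithinAt_Ici hs hst hd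
    fun t ht _ => (abs_le.1 (hR t (hs.trans ht))).2
  have h2 := sub_le_of_hasDerivWithinAt_Ici (C := R) hs hst (fun t ht => (hd t ht).neg)
    fun t ht _ => by have := (abs_le.1 (hR t (hs.trans ht))).1; linarith
  exact abs_le.2 ⟨by simp only [Pi.neg_apply] at h2; linarith, h1⟩

/-- The derivative is `⟨X, w⟩ - ⟨r, Z⟩`; freezing `⟨r, Z⟩` at the right endpoint costs the error `R
* (t - s)`. -/
theorem scaledObj_sub_le (hM : M.PosSemidef) (h : IsMirrorFlow M r a L X Z) (ha : ∀ i, 0 < a i)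
    (hL : 0 < L) (hR : ∀ s, 0 ≤ s → |r ⬝ᵥ X s| ≤ R) {s t : ℝ} (hs : 0 ≤ s) (hst : s ≤ t) :
    scaledObj M r t (Z t) - scaledObj M r s (Z s) ≤
      ((∑ i, a i) / L - r ⬝ᵥ Z t + R * (t - s)) * (t - s) := by
  have hR0 : 0 ≤ R := (abs_nonneg _).trans (hR 0 le_rfl)
  refine sub_le_of_hasDerivWithinAt_Ici hs hst
    (fun τ hτ => h.hasDeriv_scaledObj hM hτ) fun τ h1 h2 => ?_
  have h3 := h.dotProduct_slack_le ha hL (hs.trans h1)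
  have h4 := (abs_le.1 (h.dotProduct_sub_le hR (hs.trans h1) h2)).2
  have : R * (t - τ) ≤ R * (t - s) := mul_le_mul_of_nonneg_left (by linarith) hR0
  linarith

/-- Growth of the objective from `0`, with the nonnegative quadratic term dropped, gives a bound on
`Z` independent of `L`. -/
theorem sum_le (hM : M.PosSemidef) (h : IsMirrorFlow M r a L X Z) (ha : ∀ i, 0 < a i)
    (hL : 1 ≤ L) (hR : ∀ s, 0 ≤ s → |r ⬝ᵥ X s| ≤ R) {s : ℝ} (hs : 0 ≤ s) :
    ∑ i, Z s i ≤ (∑ i, a i) * s + 3 * R * s ^ 2 := by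
  have h1 := h.scaledObj_sub_le hM ha (by linarith) hR le_rfl hs
  have h2 := abs_le.1 (h.dotProduct_sub_le hR le_rfl hs)
  have h3 : (∑ i, a i) / L ≤ ∑ i, a i :=
    div_le_self (Finset.sum_nonneg fun i _ => (ha i).le) hL
  have h4 := dotProduct_mulVec_self_nonneg hM (Z s)
  simp only [h.zero, scaledObj, dotProduct_zero, mulVec_zero, Pi.zero_apply,
    Finset.sum_const_zero, sub_zero, mul_zero, add_zero] at h1 h2
  have h5 := mul_le_mul_of_nonneg_right h3 hs
  have h6 := mul_le_mul_of_nonneg_right h2.1 hs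
  have h7 := mul_le_mul_of_nonneg_right h2.2 hs
  nlinarith

/-- The slack is bounded below up to `O(log L / L)`. -/
theorem neg_slack_le (h : IsMirrorFlow M r a L X Z) (ha : ∀ i, 0 < a i) (hL : 1 ≤ L) (i : ι)
    {C B S : ℝ} (hC : ∀ s, 0 ≤ s → |(M *ᵥ X s) i - r i| ≤ C)
    (hB : ∀ s, 0 ≤ s → s ≤ S → Z s i ≤ B) {s : ℝ} (hs : 0 ≤ s) (hsS : s ≤ S) :
    -slack M r s (Z s) i ≤ Real.log (1 + L * (C * B / a i)) / L := by
  have hL0 : 0 < L := by linarith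
  have hC0 : 0 ≤ C := (abs_nonneg _).trans (hC 0 le_rfl)
  -- Since `X' ≤ L C X = L C Z'`, `X` grows at most linearly in `L`; the logarithm of its
  -- exponential form then bounds the slack.
  have h1 := sub_le_of_hasDerivWithinAt_Ici (f := fun t => X t i - L * C * Z t i) (C := 0)
    le_rfl hs (fun t ht => (h.hasDeriv_X ht i).sub ((h.hasDeriv t ht i).const_mul (L * C)))
    (fun t ht _ => by
      have h2 := (abs_le.1 (hC t ht)).1
      have h3 := mul_nonneg (mul_nonneg hL0.le (h.pos ha ht i).le)
        (by linarith : 0 ≤ C + ((M *ᵥ X t) i - r i))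
      linarith)
  have h0 : X 0 i ≤ a i := by
    rw [h.eq_exp 0 le_rfl i, h.zero]
    refine mul_le_of_le_one_right (ha i).le (Real.exp_le_one_iff.2 ?_)
    simp [slack]; linarith
  have hz : Z 0 i = 0 := by rw [h.zero]; rfl
  have h2 : X s i ≤ a i + L * C * B := by
    have := mul_le_mul_of_nonneg_left (hB s hs hsS) (mul_nonneg hL0.le hC0)
    rw [hz] at h1
    linarith
  rw [h.eq_exp s hs i] at h2
  have h3 : Real.exp (-L * slack M r s (Z s) i) ≤ 1 + L * (C * B / a i) := by
    have hai := ha i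
    have : 1 + L * (C * B / a i) = (a i + L * C * B) / a i := by field_simp
    rw [this, le_div_iff₀ hai]
    linarith
  have h4 := Real.log_le_log (Real.exp_pos _) h3
  rw [Real.log_exp] at h4
  rw [le_div_iff₀ hL0]
  linarith

/-! ### Comparison with the path of minimizers -/

variable {zs : ℝ → ι → ℝ} {S : ℝ} {δ : ι → ℝ}

/-- The flow stays close to a monotone path of minimizers in the seminorm of `M`. -/
theorem dist_le (hM : M.PosSemidef) (h : IsMirrorFlow M r a L X Z) (ha : ∀ i, 0 < a i)
    (hL : 0 < L) (hR : ∀ s, 0 ≤ s → |r ⬝ᵥ X s| ≤ R) (hzs0 : zs 0 = 0)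
    (hzs : ∀ s, 0 ≤ s → 0 ≤ zs s ∧ ∀ z, 0 ≤ z → scaledObj M r s (zs s) ≤ scaledObj M r s z)
    (hmono : ∀ i, MonotoneOn (fun s => zs s i) (Ici 0))
    (hδ : ∀ s, 0 ≤ s → s ≤ S → ∀ i, -slack M r s (Z s) i ≤ δ i) (hS : 0 ≤ S) :
    1 / 2 * ((Z S - zs S) ⬝ᵥ M *ᵥ (Z S - zs S)) ≤
      (∑ i, a i) / L * S + ∑ i, δ i * zs S i := by
  have key := sub_le_mul_of_step_bound (A := (∑ i, a i) / L) (C := R) hS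
    -- Subtracting `δ ⬝ᵥ zs s` absorbs the slack error, which telescopes along the monotone path.
    (f := fun s => 1 / 2 * ((Z s - zs s) ⬝ᵥ M *ᵥ (Z s - zs s)) - δ ⬝ᵥ zs s) ?_
  · simp only [hzs0, h.zero, sub_zero, mulVec_zero, dotProduct_zero, mul_zero] at key
    change _ ≤ _ + δ ⬝ᵥ zs S
    linarith
  intro s t hs hst htS
  have ht : 0 ≤ t := hs.trans hst
  -- the flow's own increment
  have e1 := h.scaledObj_sub_le hM ha hL hR hs hst
  -- minimality at the later time
  have e2 := (hzs t ht).2 (zs s) (hzs s hs).1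
  -- nonnegativity of the slack at the minimizer
  have e3 : 0 ≤ (Z t - Z s) ⬝ᵥ slack M r s (zs s) :=
    Finset.sum_nonneg fun i _ => mul_nonneg (sub_nonneg.2 (h.monotone ha hs hst i))
      (slack_nonneg_of_isMin hM (hzs s hs).1 (hzs s hs).2 i)
  -- almost nonnegativity of the slack along the flow
  have e4 : 0 ≤ (zs t - zs s) ⬝ᵥ slack M r t (Z t) + δ ⬝ᵥ (zs t - zs s) := by
    simp only [dotProduct, ← Finset.sum_add_distrib]
    refine Finset.sum_nonneg fun i _ => ?_
    have h1 := hδ t ht htS i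
    have h2 : 0 ≤ (zs t - zs s) i := sub_nonneg.2 (hmono i hs ht hst)
    nlinarith
  rw [slack_dotProduct] at e3 e4
  simp only [scaledObj, mulVec_sub, dotProduct_sub, sub_dotProduct, Pi.sub_apply,
    Finset.sum_sub_distrib] at e1 e2 e3 e4 ⊢
  rw [dotProduct_mulVec_symm hM (zs s) (Z t)] at e4
  rw [dotProduct_mulVec_symm hM (zs t) (Z t)] at e4 ⊢
  rw [dotProduct_mulVec_symm hM (zs s) (Z s)]
  linarith

/-- The suboptimality of the flow is controlled by the distance in the seminorm of `M`. -/
theorem suboptimality_le (hM : M.PosSemidef) (hq : M *ᵥ q = r) (h : IsMirrorFlow M r a L X Z)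
    (ha : ∀ i, 0 < a i) (hL : 0 < L) (hR : ∀ s, 0 ≤ s → |r ⬝ᵥ X s| ≤ R) (hzs0 : zs 0 = 0)
    (hzs : ∀ s, 0 ≤ s → 0 ≤ zs s ∧ ∀ z, 0 ≤ z → scaledObj M r s (zs s) ≤ scaledObj M r s z)
    {η : ℝ} (hη : ∀ s, 0 ≤ s → s ≤ S → (Z s - zs s) ⬝ᵥ M *ᵥ (Z s - zs s) ≤ η) (hS : 0 ≤ S) :
    scaledObj M r S (Z S) - scaledObj M r S (zs S) ≤
      ((∑ i, a i) / L + √((q ⬝ᵥ M *ᵥ q) * η)) * S := by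
  have key := sub_le_mul_of_step_bound (A := (∑ i, a i) / L + √((q ⬝ᵥ M *ᵥ q) * η)) (C := R) hS
    (f := fun s => scaledObj M r s (Z s) - scaledObj M r s (zs s)) ?_
  · simp only [hzs0, h.zero, sub_self, sub_zero] at key
    exact key
  intro s t hs hst htS
  have ht : 0 ≤ t := hs.trans hst
  have e1 := h.scaledObj_sub_le hM ha hL hR hs hst
  -- Envelope inequality: testing minimality at time `s` with `zs t` bounds the decrease of the
  -- minimum value.
  have e2 := (hzs s hs).2 (zs t) (hzs t ht).1
  have e5 := scaledObj_add_time M r s t (zs t)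
  have e3 := (abs_le.1 (abs_dotProduct_mulVec_le hM q _ (hη t ht htS))).1
  have e6 : q ⬝ᵥ M *ᵥ (Z t - zs t) = r ⬝ᵥ Z t - r ⬝ᵥ zs t := by
    rw [dotProduct_mulVec_symm hM, hq, dotProduct_comm, dotProduct_sub]
  rw [e6] at e3
  have e4 := mul_le_mul_of_nonneg_right e3 (sub_nonneg.2 hst)
  linarith

end IsMirrorFlow

/-! ### The limit `L → ∞` -/

theorem tendsto_log_one_add_mul_div {c : ℝ} (hc : 0 ≤ c) :
    Tendsto (fun L : ℝ => Real.log (1 + L * c) / L) atTop (𝓝 0) := by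
  have h1 : Tendsto (fun L : ℝ => (Real.log (1 + c) + Real.log L) / L) atTop (𝓝 (0 + 0)) := by
    simp_rw [add_div]
    refine (tendsto_const_nhds.div_atTop tendsto_id).add ?_
    exact Real.isLittleO_log_id_atTop.tendsto_div_nhds_zero
  rw [add_zero] at h1
  refine tendsto_of_tendsto_of_tendsto_of_le_of_le' tendsto_const_nhds h1 ?_ ?_
  · filter_upwards [eventually_ge_atTop 1] with L hL
    have : 0 ≤ L * c := mul_nonneg (by linarith) hc
    exact div_nonneg (Real.log_nonneg (by linarith)) (by linarith)
  · filter_upwards [eventually_ge_atTop 1] with L hL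
    have hL0 : 0 < L := by linarith
    rw [← Real.log_mul (by positivity) hL0.ne']
    refine div_le_div_of_nonneg_right (Real.log_le_log (by positivity) ?_) hL0.le
    nlinarith

/-- As `L → ∞`, the mirror flows become optimal, uniformly over all flows with parameter `L`. -/
theorem exists_suboptimality_bound {M : Matrix ι ι ℝ} (hM : M.PosSemidef) {r a q : ι → ℝ}
    (hq : M *ᵥ q = r) (ha : ∀ i, 0 < a i) {zs : ℝ → ι → ℝ} (hzs0 : zs 0 = 0)
    (hzs : ∀ s, 0 ≤ s → 0 ≤ zs s ∧ ∀ z, 0 ≤ z → scaledObj M r s (zs s) ≤ scaledObj M r s z)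
    (hmono : ∀ i, MonotoneOn (fun s => zs s i) (Ici 0)) {S : ℝ} (hS : 0 ≤ S) :
    ∃ b : ℝ → ℝ, Tendsto b atTop (𝓝 0) ∧ ∀ L, 1 ≤ L → ∀ X Z : ℝ → ι → ℝ,
      IsMirrorFlow M r a L X Z →
      scaledObj M r S (Z S) - scaledObj M r S (zs S) ≤ b L := by
  classical
  set K := 2 * (a ⬝ᵥ M *ᵥ a) + 2 * (q ⬝ᵥ M *ᵥ q) with hK
  set R := |r ⬝ᵥ q| + √((q ⬝ᵥ M *ᵥ q) * K) with hR
  have hR0 : 0 ≤ R := by positivity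
  -- Testing the residual bound against the `i`-th basis vector gives this constant.
  set C : ι → ℝ := fun i =>
    √(((Pi.single i 1 : ι → ℝ) ⬝ᵥ M *ᵥ (Pi.single i 1 : ι → ℝ)) * K) with hC
  have hA : 0 ≤ ∑ i, a i := Finset.sum_nonneg fun i _ => (ha i).le
  set B := (∑ i, a i) * S + 3 * R * S ^ 2 with hB
  have hB0 : 0 ≤ B := by positivity
  set δ : ℝ → ι → ℝ := fun L i => Real.log (1 + L * (C i * B / a i)) / L with hδ
  have hc : ∀ i, 0 ≤ C i * B / a i := fun i =>
    div_nonneg (mul_nonneg (Real.sqrt_nonneg _) hB0) (ha i).le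
  set η : ℝ → ℝ := fun L => 2 * ((∑ i, a i) / L * S + ∑ i, δ L i * zs S i) with hη
  have hAL : Tendsto (fun L : ℝ => (∑ i, a i) / L) atTop (𝓝 0) :=
    tendsto_const_nhds.div_atTop tendsto_id
  have hη0 : Tendsto η atTop (𝓝 0) := by
    have h1 : Tendsto (fun L => ∑ i, δ L i * zs S i) atTop (𝓝 (∑ i, 0 * zs S i)) :=
      tendsto_finsetSum _ fun i _ => (tendsto_log_one_add_mul_div (hc i)).mul_const _
    have h2 := ((hAL.mul_const S).add h1).const_mul 2
    simpa using h2
  refine ⟨fun L => ((∑ i, a i) / L + √((q ⬝ᵥ M *ᵥ q) * η L)) * S, ?_, ?_⟩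
  · have h1 := (hAL.add (hη0.const_mul (q ⬝ᵥ M *ᵥ q)).sqrt).mul_const S
    simpa using h1
  intro L hL X Z h
  have hL0 : 0 < L := by linarith
  have hRX : ∀ s, 0 ≤ s → |r ⬝ᵥ X s| ≤ R := fun s hs => h.abs_dotProduct_le hM hq ha hL hs
  have hδ0 : ∀ i, 0 ≤ δ L i := fun i =>
    div_nonneg (Real.log_nonneg (by have := mul_nonneg hL0.le (hc i); linarith)) hL0.le
  have hCX : ∀ i, ∀ s, 0 ≤ s → |(M *ᵥ X s) i - r i| ≤ C i := by
    intro i s hs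
    have := h.abs_dotProduct_residual_le hM hq ha hL hs (Pi.single i 1)
    rwa [single_one_dotProduct] at this
  have hBZ : ∀ i, ∀ s, 0 ≤ s → s ≤ S → Z s i ≤ B := by
    intro i s hs hsS
    have h1 := h.sum_le hM ha hL hRX hs
    have h2 := Finset.single_le_sum (f := Z s) (fun j _ => h.nonneg ha hs j) (Finset.mem_univ i)
    refine h2.trans (h1.trans ?_)
    rw [hB]
    gcongr
  have hslack : ∀ s, 0 ≤ s → s ≤ S → ∀ i, -slack M r s (Z s) i ≤ δ L i :=
    fun s hs hsS i => h.neg_slack_le ha hL i (hCX i) (hBZ i) hs hsS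
  refine h.suboptimality_le hM hq ha hL0 hRX hzs0 hzs (η := η L) ?_ hS
  intro s hs hsS
  have h1 := h.dist_le hM ha hL0 hRX hzs0 hzs hmono
    (fun t ht hts => hslack t ht (hts.trans hsS)) hs
  have h2 : (∑ i, a i) / L * s ≤ (∑ i, a i) / L * S := by gcongr
  have h3 : ∑ i, δ L i * zs s i ≤ ∑ i, δ L i * zs S i :=
    Finset.sum_le_sum fun i _ => mul_le_mul_of_nonneg_left (hmono i hs hS hsS) (hδ0 i)
  simp only [hη]
  linarith

/-! ### From the gradient flow to a mirror flow -/

variable {d : ℕ} {M : Matrix (Fin d) (Fin d) ℝ} {r : EuclideanSpace ℝ (Fin d)}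

theorem loss_eq (M : Matrix (Fin d) (Fin d) ℝ) (r x : EuclideanSpace ℝ (Fin d)) :
    loss M r x = 1 / 2 * (x.ofLp ⬝ᵥ M *ᵥ x.ofLp) - r.ofLp ⬝ᵥ x.ofLp := by
  simp only [loss, EuclideanSpace.inner_eq_star_dotProduct, ofLp_toLpLin, Matrix.toLin'_apply, star_trivial]
  rw [dotProduct_comm, dotProduct_comm x.ofLp r.ofLp]

theorem sq_mul_lasso {x : EuclideanSpace ℝ (Fin d)} (hx : x ∈ nonnegOrthant d) {s : ℝ}
    (hs : 0 < s) : s ^ 2 * lasso M r x (1 / s) = scaledObj M r.ofLp s (s • x.ofLp) := by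
  have h : ∑ i, |x i| = ∑ i, x i := Finset.sum_congr rfl fun i _ => abs_of_nonneg (hx i)
  rw [lasso, loss_eq, scaledObj, h]
  simp only [mulVec_smul, smul_dotProduct, dotProduct_smul, smul_eq_mul, Pi.smul_apply,
    ← Finset.mul_sum]
  field_simp

theorem gradient_loss_hsq (hM : M.PosSemidef) (v : EuclideanSpace ℝ (Fin d)) :
    gradient (fun v => loss M r (hsq v)) v =
      WithLp.toLp 2 (fun i => 2 * v i * ((M *ᵥ (hsq v).ofLp) i - r i)) := by
  refine HasGradientAt.gradient ?_
  rw [hasGradientAt_iff_hasFDerivAt]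
  have hp : ∀ i, HasFDerivAt (fun v : EuclideanSpace ℝ (Fin d) => (hsq v).ofLp i)
      (v i • EuclideanSpace.proj (𝕜 := ℝ) i + v i • EuclideanSpace.proj (𝕜 := ℝ) i) v :=
    fun i => (EuclideanSpace.proj (𝕜 := ℝ) i).hasFDerivAt.mul
      (EuclideanSpace.proj (𝕜 := ℝ) i).hasFDerivAt
  have hMp : ∀ i, HasFDerivAt (fun v : EuclideanSpace ℝ (Fin d) => (M *ᵥ (hsq v).ofLp) i) _ v :=
    fun i => HasFDerivAt.fun_sum (u := Finset.univ) fun j _ => (hp j).const_mul (M i j)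
  have hq := HasFDerivAt.fun_sum (u := Finset.univ) fun i _ => (hp i).mul (hMp i)
  have hl := HasFDerivAt.fun_sum (u := Finset.univ) fun i _ => (hp i).const_mul (r i)
  have hloss := (hq.const_mul (1 / 2)).sub hl
  refine (hloss.congr_of_eventuallyEq (.of_forall fun v => loss_eq M r (hsq v))).congr_fderiv ?_
  ext w
  set g : Fin d → ℝ := fun i => 2 * v i * w i with hg
  have hsym := dotProduct_mulVec_symm hM (hsq v).ofLp g
  have e1 : ((InnerProductSpace.toDual ℝ (EuclideanSpace ℝ (Fin d)))
      (WithLp.toLp 2 (fun i => 2 * v i * ((M *ᵥ (hsq v).ofLp) i - r i)))) w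
      = g ⬝ᵥ M *ᵥ (hsq v).ofLp - r.ofLp ⬝ᵥ g := by
    rw [InnerProductSpace.toDual_apply_apply, EuclideanSpace.inner_eq_star_dotProduct]
    simp only [dotProduct, star_trivial, ← Finset.sum_sub_distrib, hg]
    exact Finset.sum_congr rfl fun i _ => by ring
  rw [e1]
  have e2 : 1 / 2 * ((hsq v).ofLp ⬝ᵥ M *ᵥ g + g ⬝ᵥ M *ᵥ (hsq v).ofLp) - r.ofLp ⬝ᵥ g =
      g ⬝ᵥ M *ᵥ (hsq v).ofLp - r.ofLp ⬝ᵥ g := by rw [hsym]; ring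
  rw [← e2]
  simp only [_root_.sub_apply, _root_.smul_apply, _root_.sum_apply, _root_.add_apply, smul_eq_mul]
  have e3 : ∀ i, v i * EuclideanSpace.proj (𝕜 := ℝ) i w + v i * EuclideanSpace.proj (𝕜 := ℝ) i w
      = g i := fun i => by
    change v i * w i + v i * w i = 2 * v i * w i
    ring
  simp only [e3, dotProduct, Finset.sum_add_distrib, mulVec]
  congr 3
  exact Finset.sum_congr rfl fun i _ => mul_comm _ _

variable {u : ℝ → EuclideanSpace ℝ (Fin d)} {u₀ : EuclideanSpace ℝ (Fin d)}

theorem continuous_hsq : Continuous (hsq : EuclideanSpace ℝ (Fin d) → _) := by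
  unfold hsq
  fun_prop

namespace IsGradientFlow

/-- Extending `u` by `u 0` to negative times makes the integrand continuous on `ℝ`, so its integral
has a two-sided derivative even at `0`. -/
theorem continuous_max (h : IsGradientFlow M r u₀ u) : Continuous fun t => u (max t 0) := by
  have hc : ContinuousOn u (Ici 0) := fun t ht => (h.2 t ht).continuousWithinAt
  exact hc.comp_continuous (by fun_prop) fun t => le_max_right t 0

theorem hasDerivAt_integral (h : IsGradientFlow M r u₀ u) {t : ℝ} (ht : 0 ≤ t) (i : Fin d) :
    HasDerivAt (fun t => ∫ τ in (0 : ℝ)..t, hsq (u (max τ 0)) i) (hsq (u t) i) t := by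
  have hc : Continuous fun τ => hsq (u (max τ 0)) i :=
    (EuclideanSpace.proj (𝕜 := ℝ) i).continuous.comp (continuous_hsq.comp h.continuous_max)
  have := intervalIntegral.integral_hasDerivAt_right (hc.intervalIntegrable 0 t)
    hc.stronglyMeasurable.stronglyMeasurableAtFilter hc.continuousAt
  rwa [max_eq_left ht] at this

theorem integral_apply (h : IsGradientFlow M r u₀ u) {t : ℝ} (ht : 0 ≤ t) (i : Fin d) :
    (∫ τ in (0 : ℝ)..t, hsq (u τ)) i = ∫ τ in (0 : ℝ)..t, hsq (u (max τ 0)) i := by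
  have e : ∫ τ in (0 : ℝ)..t, hsq (u τ) = ∫ τ in (0 : ℝ)..t, hsq (u (max τ 0)) := by
    refine intervalIntegral.integral_congr fun τ hτ => ?_
    rw [uIcc_of_le ht] at hτ
    simp only [max_eq_left hτ.1]
  rw [e]
  exact ((EuclideanSpace.proj (𝕜 := ℝ) i).intervalIntegral_comp_comm
    ((continuous_hsq.comp h.continuous_max).intervalIntegrable 0 t)).symm

/-- The flow in exponential form. -/
theorem mul_exp_eq (hM : M.PosSemidef) (h : IsGradientFlow M r u₀ u) {t : ℝ} (ht : 0 ≤ t)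
    (i : Fin d) :
    u t i * Real.exp (2 * ((M *ᵥ fun j => ∫ τ in (0 : ℝ)..t, hsq (u (max τ 0)) j) i - t * r i))
      = u₀ i := by
  set J : ℝ → Fin d → ℝ := fun t j => ∫ τ in (0 : ℝ)..t, hsq (u (max τ 0)) j with hJ
  -- An integrating factor for `u' = -2 u (M x - r)`; no sign of `u` is needed.
  have hd : ∀ t, 0 ≤ t → HasDerivWithinAt
      (fun t => u t i * Real.exp (2 * ((M *ᵥ J t) i - t * r i))) 0 (Ici 0) t := by
    intro t ht
    have h1 : HasDerivWithinAt (fun t => u t i)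
        (-(2 * u t i * ((M *ᵥ (hsq (u t)).ofLp) i - r i))) (Ici 0) t := by
      have h2 := h.2 t ht
      rw [gradient_loss_hsq hM] at h2
      exact (EuclideanSpace.proj (𝕜 := ℝ) i).hasFDerivAt.comp_hasDerivWithinAt t h2
    have h2 : HasDerivWithinAt (fun t => (M *ᵥ J t) i) ((M *ᵥ (hsq (u t)).ofLp) i) (Ici 0) t :=
      hasDerivWithinAt_dotProduct (fun j => (h.hasDerivAt_integral ht j).hasDerivWithinAt) (M i)
    have h3 := h1.mul
      (((h2.sub ((hasDerivWithinAt_id t (Ici 0)).mul_const (r i))).const_mul 2).exp)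
    refine h3.congr_deriv ?_
    simp only [Pi.sub_apply, id]
    ring
  have h1 := sub_le_of_hasDerivWithinAt_Ici (C := 0) le_rfl ht hd fun _ _ _ => le_rfl
  have h2 := sub_le_of_hasDerivWithinAt_Ici (C := 0) le_rfl ht (fun t ht => (hd t ht).neg)
    fun _ _ _ => by simp
  have h0 : u 0 i * Real.exp (2 * ((M *ᵥ J 0) i - 0 * r i)) = u₀ i := by
    have : J 0 = 0 := by ext j; simp [hJ]
    simp [this, h.1]
  simp only [Pi.neg_apply] at h2
  rw [← h0]
  linarith

/-- In the time scale `t = (L / 4) s` with `L = log (1 / ε)`, the gradient flow started at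
`√ε α` becomes a mirror flow. -/
theorem isMirrorFlow (hM : M.PosSemidef) {α : EuclideanSpace ℝ (Fin d)} {ε : ℝ} (hε : 0 < ε)
    (hε1 : ε < 1) (h : IsGradientFlow M r (√ε • α) u) :
    IsMirrorFlow M r.ofLp (fun i => α i ^ 2) (Real.log (1 / ε))
      (fun s => (hsq (u (timeOf ε s))).ofLp)
      (fun s i => 4 / Real.log (1 / ε) *
        ∫ τ in (0 : ℝ)..timeOf ε s, hsq (u (max τ 0)) i) := by
  have hL : 0 < Real.log (1 / ε) := Real.log_pos (by rw [lt_div_iff₀ hε]; linarith)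
  have hexp : Real.exp (-Real.log (1 / ε)) = ε := by
    rw [one_div, Real.log_inv, neg_neg, Real.exp_log hε]
  set L := Real.log (1 / ε) with hLdef
  have hT : ∀ s, 0 ≤ s → 0 ≤ timeOf ε s := fun s hs => mul_nonneg (by positivity) hs
  refine ⟨?_, ?_, ?_⟩
  · ext i; simp [timeOf]
  · intro s hs i
    have h1 : HasDerivAt (fun s => timeOf ε s) (L / 4 * 1) s :=
      (hasDerivAt_id s).const_mul (L / 4)
    have h2 := ((h.hasDerivAt_integral (hT s hs) i).comp s h1).const_mul (4 / L)
    refine h2.hasDerivWithinAt.congr_deriv ?_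
    field_simp
  · intro s hs i
    have h1 := h.mul_exp_eq hM (hT s hs) i
    set J : Fin d → ℝ := fun j => ∫ τ in (0 : ℝ)..timeOf ε s, hsq (u (max τ 0)) j with hJ
    set p := 2 * ((M *ᵥ J) i - timeOf ε s * r i) with hp
    have e1 : (fun i => 4 / L * ∫ τ in (0 : ℝ)..timeOf ε s, hsq (u (max τ 0)) i) =
        (4 / L) • J := rfl
    have e2 : -L * slack M r.ofLp s ((4 / L) • J) i = -L + (-p + -p) := by
      rw [hp, slack, mulVec_smul]
      simp only [timeOf, ← hLdef, Pi.smul_apply, smul_eq_mul]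
      field_simp
      ring
    have e3 : u (timeOf ε s) i = √ε * α i * Real.exp (-p) := by
      have h4 : Real.exp p * Real.exp (-p) = 1 := by rw [← Real.exp_add]; simp
      have h5 : (√ε • α) i = √ε * α i := rfl
      rw [← h5, ← h1, mul_assoc, h4, mul_one]
    rw [e1, e2, Real.exp_add, Real.exp_add, hexp]
    change u (timeOf ε s) i * u (timeOf ε s) i = _
    rw [e3]
    have h6 := Real.mul_self_sqrt hε.le
    linear_combination (α i ^ 2 * Real.exp (-p) * Real.exp (-p)) * h6

end IsGradientFlow

end DLN

/-! ### Conclusion -/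

theorem theorem3 (d : ℕ) (M : Matrix (Fin d) (Fin d) ℝ) (r α : EuclideanSpace ℝ (Fin d))
    (hM : M.PosSemidef)
    (hr : r ∈ LinearMap.range (Matrix.toEuclideanLin M))
    (hα : ∀ i, α i ≠ 0)
    (u : ℝ → ℝ → EuclideanSpace ℝ (Fin d))
    (hu : ∀ ε ∈ Set.Ioo (0 : ℝ) 1, DLN.IsGradientFlow M r (Real.sqrt ε • α) (u ε))
    (x : ℝ → EuclideanSpace ℝ (Fin d))
    (hx : ∀ s : ℝ, 0 < s → DLN.IsPosLassoMinimizer M r (1 / s) (x s))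
    (hmono : ∀ i, MonotoneOn (fun s : ℝ => s * x s i) (Set.Ioi 0)) :
    ∀ s : ℝ, 0 < s →
      Filter.Tendsto
        (fun ε : ℝ => DLN.lasso M r (DLN.avgTrajectory (u ε) (DLN.timeOf ε s)) (1 / s))
        (nhdsWithin 0 (Set.Ioi 0))
        (nhds (DLN.posLassoMin M r (1 / s))) := by
  intro S hS
  obtain ⟨q, hq⟩ := hr
  have hq' : M *ᵥ q.ofLp = r.ofLp := by rw [← hq, ofLp_toLpLin, Matrix.toLin'_apply]
  have hzs : ∀ s, 0 ≤ s → 0 ≤ s • (x s).ofLp ∧ ∀ z, 0 ≤ z →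
      DLN.scaledObj M r.ofLp s (s • (x s).ofLp) ≤ DLN.scaledObj M r.ofLp s z := by
    intro s hs
    -- At `s = 0` the path is `0` whatever `x 0` is, and it minimizes the objective there.
    rcases hs.eq_or_lt with rfl | hs
    · refine ⟨by simp, fun z hz => ?_⟩
      have h1 := DLN.dotProduct_mulVec_self_nonneg hM z
      have h2 : 0 ≤ ∑ i, z i := Finset.sum_nonneg fun i _ => hz i
      simp only [DLN.scaledObj, zero_smul, zero_mul, sub_zero, mulVec_zero, dotProduct_zero,
        mul_zero, Pi.zero_apply, Finset.sum_const_zero, add_zero]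
      linarith
    · refine ⟨fun i => mul_nonneg hs.le ((hx s hs).1 i), fun z hz => ?_⟩
      have hy : WithLp.toLp 2 (s⁻¹ • z) ∈ DLN.nonnegOrthant d :=
        fun i => mul_nonneg (inv_nonneg.2 hs.le) (hz i)
      have h1 := mul_le_mul_of_nonneg_left ((hx s hs).2 hy) (sq_nonneg s)
      simp only at h1
      rwa [DLN.sq_mul_lasso (hx s hs).1 hs, DLN.sq_mul_lasso hy hs, smul_smul,
        mul_inv_cancel₀ hs.ne', one_smul] at h1
  have hmono' : ∀ i, MonotoneOn (fun s => (s • (x s).ofLp) i) (Ici 0) := by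
    intro i s hs t ht hst
    rcases (mem_Ici.1 hs).eq_or_lt with rfl | hs'
    · simpa using (hzs t ht).1 i
    · exact hmono i hs' (hs'.trans_le hst) hst
  obtain ⟨b, hb, hbound⟩ := DLN.exists_suboptimality_bound hM hq' (a := fun i => α i ^ 2)
    (fun i => by have := hα i; positivity) (zs := fun s => s • (x s).ofLp) (by simp) hzs hmono'
    hS.le
  have hlog : Tendsto (fun ε : ℝ => Real.log (1 / ε)) (𝓝[>] 0) atTop := by
    simp only [one_div]
    exact Real.tendsto_log_atTop.comp tendsto_inv_nhdsGT_zero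
  have hlim : Tendsto (fun ε : ℝ => DLN.posLassoMin M r (1 / S) + b (Real.log (1 / ε)) / S ^ 2)
      (𝓝[>] 0) (𝓝 (DLN.posLassoMin M r (1 / S) + 0 / S ^ 2)) :=
    ((hb.comp hlog).div_const _).const_add _
  rw [zero_div, add_zero] at hlim
  have hε1 : ∀ᶠ ε : ℝ in 𝓝[>] 0, ε < 1 := nhdsWithin_le_nhds (gt_mem_nhds one_pos)
  have hmem : ∀ ε ∈ Ioo (0 : ℝ) 1,
      DLN.avgTrajectory (u ε) (DLN.timeOf ε S) ∈ DLN.nonnegOrthant d ∧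
      S • (DLN.avgTrajectory (u ε) (DLN.timeOf ε S)).ofLp = fun i => 4 / Real.log (1 / ε) *
        ∫ τ in (0 : ℝ)..DLN.timeOf ε S, DLN.hsq (u ε (max τ 0)) i := by
    intro ε hε
    have hL : 0 < Real.log (1 / ε) :=
      Real.log_pos (by rw [lt_div_iff₀ hε.1]; linarith [hε.2])
    have hT : 0 < DLN.timeOf ε S := mul_pos (by positivity) hS
    have happ : ∀ i, (DLN.avgTrajectory (u ε) (DLN.timeOf ε S)) i = 1 / DLN.timeOf ε S *
        ∫ τ in (0 : ℝ)..DLN.timeOf ε S, DLN.hsq (u ε (max τ 0)) i := by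
      intro i
      rw [← (hu ε hε).integral_apply hT.le i]
      rfl
    constructor
    · intro i
      rw [happ]
      exact mul_nonneg (by positivity) (intervalIntegral.integral_nonneg hT.le
        fun τ _ => mul_self_nonneg _)
    · ext i
      rw [Pi.smul_apply, happ, DLN.timeOf, smul_eq_mul]
      field_simp
  refine tendsto_of_tendsto_of_tendsto_of_le_of_le' tendsto_const_nhds hlim ?_ ?_
  · filter_upwards [self_mem_nhdsWithin, hε1] with ε h0 h1
    rw [(hx S hS).eq_posLassoMin]
    exact (hx S hS).2 (hmem ε ⟨h0, h1⟩).1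
  · filter_upwards [self_mem_nhdsWithin, hε1, hlog.eventually_ge_atTop 1] with ε h0 h1 hL
    obtain ⟨hnn, hsm⟩ := hmem ε ⟨h0, h1⟩
    have h2 := hbound _ hL _ _ ((hu ε ⟨h0, h1⟩).isMirrorFlow hM h0 h1)
    simp only at h2
    rw [← hsm, ← DLN.sq_mul_lasso hnn hS, ← DLN.sq_mul_lasso (hx S hS).1 hS,
      ← (hx S hS).eq_posLassoMin] at h2
    have hS2 : 0 < S ^ 2 := by positivity
    rw [← sub_le_iff_le_add', le_div_iff₀ hS2]
    linarith
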